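/- Let $E$ be a locally convex Hausdorff space over $\mathbb{K}=\mathbb{R}$ or $\mathbb{C}$ with topological dual $E'$. Assume that $E$ is locally complete, i.e. for every closed, bounded, absolutely convex non-empty set $D\subset E$ the space $E_D=\bigcup_{n\in\mathbb{N}} nD$, normed by the gauge of $D$, is a Banach space. Assume also that $E$ is a generalised Gelfand space, i.e. every Lipschitz continuous map $[0,1]\to E$ is differentiable Lebesgue-almost everywhere; here a map $F$ on a set $S\subset\mathbb{R}$ is called Lipschitz continuous if for every continuous seminorm $p$ on $E$ there is $C\ge 0$ with $p(F(x)-F(y))\le C|x-y|$ for all $x,y\in S$. Let $G\subset E'$ be a linear subspace that determines boundedness, i.e. every set $B\subset E$ with $\sup_{x\in B}|e'(x)|<\infty$ for all $e'\in G$ is bounded in $E$. Let $\Omega\subset\mathbb{R}$ be open and $k\in\mathbb{N}$, $k\geq 1$. If $f\colon\Omega\to E$ is such that $e'\circ f\in\mathcal{C}^{k}(\Omega)$ for all $e'\in G$, then $f\in\mathcal{C}^{k-1,1}_{loc}(\Omega,E)$, and the $k$-th derivative $f^{(k)}(x)=\lim_{h\to 0}\frac{f^{(k-1)}(x+h)-f^{(k-1)}(x)}{h}$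 exists in $E$ for Lebesgue-almost all $x\in\Omega$. Here $f\in\mathcal{C}^{m,1}_{loc}(\Omega,E)$ means that $f$ is $m$ times continuously differentiable on $\Omega$ (derivatives being limits of difference quotients in the topology of $E$) and that on every compact $K\subset\Omega$ the derivatives of $f$ up to order $m$ are bounded with respect to every continuous seminorm and $f^{(m)}$ is Lipschitz continuous on $K$. -/

import Mathlib

open Filter Topology MeasureTheory Set
open scoped Pointwise

noncomputable section

namespace AlmostWeakStrong

section Derivative

variable {E : Type*} [AddCommGroup E] [Module ℝ E] [TopologicalSpace E]

/-- The difference quotients `(f (x + h) - f x) / h` converge to `v` in `E` as `h → 0`, `h ≠ 0`.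
Functions on an open set `Ω ⊆ ℝ` are represented by functions on `ℝ`; at points of `Ω` the notion
depends only on the values on `Ω`. -/
def HasDerivative (f : ℝ → E) (v : E) (x : ℝ) : Prop :=
  Tendsto (fun h : ℝ => h⁻¹ • (f (x + h) - f x)) (𝓝[≠] 0) (𝓝 v)

/-- The derivative of `f` at `x` exists in `E`. -/
def DerivativeExistsAt (f : ℝ → E) (x : ℝ) : Prop :=
  ∃ v : E, HasDerivative f v x

/-- The derivative `x ↦ lim_{h → 0} (f (x + h) - f x) / h` (meaningful where it exists). -/
def derivative (f : ℝ → E) (x : ℝ) : E :=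
  limUnder (𝓝[≠] 0) (fun h : ℝ => h⁻¹ • (f (x + h) - f x))

/-- The `j`-th derivative of `f`. -/
def iterDerivative (j : ℕ) (f : ℝ → E) : ℝ → E :=
  derivative^[j] f

/-- `f` is of class `C^m` on the open set `Ω ⊆ ℝ`: for `m = 0` it is continuous on `Ω`, and it is
of class `C^(m+1)` if its derivative exists everywhere on `Ω` and is of class `C^m` on `Ω`. -/
def IsCk : ℕ → (ℝ → E) → Set ℝ → Prop
  | 0, f, Ω => ContinuousOn f Ω
  | m + 1, f, Ω => (∀ x ∈ Ω, DerivativeExistsAt f x) ∧ IsCk m (derivative f) Ω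

end Derivative

section LocallyConvex

variable (𝕜 : Type*) [RCLike 𝕜]
variable {E : Type*} [AddCommGroup E] [Module 𝕜 E] [Module ℝ E] [TopologicalSpace E]

/-- `f` is Lipschitz continuous on `S ⊆ ℝ`: for every continuous seminorm `p` of `E` there is a
constant `C` (depending on `p`) with `p (f x - f y) ≤ C |x - y|` on `S`. -/
def IsLipschitzOn {E : Type*} [AddCommGroup E] [Module 𝕜 E] [TopologicalSpace E]
    (f : ℝ → E) (S : Set ℝ) : Prop :=
  ∀ p : Seminorm 𝕜 E, Continuous p → ∃ C : ℝ, ∀ x ∈ S, ∀ y ∈ S, p (f x - f y) ≤ C * |x - y|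

/-- `f ∈ C^{m,1}_loc(Ω, E)`: `f` is of class `C^m` on `Ω`, and on every compact `K ⊆ Ω` the
derivatives up to order `m` are bounded and the `m`-th derivative is Lipschitz continuous. -/
def IsCkLipschitzLoc (m : ℕ) (f : ℝ → E) (Ω : Set ℝ) : Prop :=
  IsCk m f Ω ∧ ∀ K : Set ℝ, IsCompact K → K ⊆ Ω →
    (∀ p : Seminorm 𝕜 E, Continuous p → ∀ j ≤ m,
      BddAbove ((fun x => p (iterDerivative j f x)) '' K)) ∧
    IsLipschitzOn 𝕜 (iterDerivative m f) K

variable (E) in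
/-- Every Lipschitz continuous map `[0,1] → E` is differentiable Lebesgue-almost everywhere.
(The end points of `[0,1]` form a null set, so only interior points are considered; there,
differentiability depends only on the values on `[0,1]`.) -/
def IsGeneralisedGelfand : Prop :=
  ∀ f : ℝ → E, IsLipschitzOn 𝕜 f (Icc 0 1) →
    ∀ᵐ x ∂(volume.restrict (Ioo (0 : ℝ) 1)), DerivativeExistsAt f x

/-- A disk: a non-empty, bounded, absolutely convex set. -/
def IsDisk (D : Set E) : Prop :=
  D.Nonempty ∧ Bornology.IsVonNBounded 𝕜 D ∧ Balanced 𝕜 D ∧ Convex ℝ D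

/-- The linear space `E_D = ⋃ n, n D`, the linear span of a disk `D`. -/
def diskSpace {E : Type*} [AddCommGroup E] [Module ℝ E] (D : Set E) : Set E :=
  ⋃ n : ℕ, (n : ℝ) • D

variable (E) in
/-- `E` is locally complete: for every closed disk `D`, the space `E_D`, normed by the gauge
of `D`, is a Banach space, i.e. each of its Cauchy sequences converges in it. -/
def IsLocallyComplete : Prop :=
  ∀ D : Set E, IsDisk 𝕜 D → IsClosed D →
    ∀ u : ℕ → E, (∀ n, u n ∈ diskSpace D) →
      (∀ ε : ℝ, 0 < ε → ∃ N : ℕ, ∀ m ≥ N, ∀ n ≥ N, gauge D (u m - u n) < ε) →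
      ∃ x ∈ diskSpace D, Tendsto (fun n => gauge D (u n - x)) atTop (𝓝 0)

/-- `G ⊆ E'` determines boundedness: every `σ(E,G)`-bounded set, i.e. every set on which each
`g ∈ G` is bounded, is bounded in `E`. -/
def DeterminesBoundedness {𝕜 : Type*} [RCLike 𝕜] {E : Type*} [AddCommGroup E] [Module 𝕜 E]
    [TopologicalSpace E] (G : Submodule 𝕜 (E →L[𝕜] 𝕜)) : Prop :=
  ∀ B : Set E, (∀ g ∈ G, Bornology.IsBounded (g '' B)) → Bornology.IsVonNBounded 𝕜 B

end LocallyConvex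

end AlmostWeakStrong

end

namespace AlmostWeakStrong

open Bornology

/-! ### Scalar estimates for `C¹` and `C²` functions -/

section Scalar

variable {F : Type*} [NormedAddCommGroup F] [NormedSpace ℝ F] {φ : ℝ → F} {Ω : Set ℝ}

/-! If `g ∘ f` is `C¹` for all `g ∈ G`, each `g` is bounded on the slopes of `f` over a compact set.
As `G` determines boundedness, the slopes are bounded in `E`: `f` is Lipschitz there, and the
Gelfand property gives differentiability a.e.

If every `g ∘ f` is `C²`, the difference quotients of `g ∘ f` at `x` converge with error at most `L
g * |h|`. Put `D = {y | ‖g y‖ ≤ L g for all g ∈ G}`, a closed disk. Along `h = c n → 0` the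
quotients of `f`, up to a fixed shift, are Cauchy in `E_D`, so local completeness yields a weak
limit `v`. Then (quotient − `v`)`/h` lies in the bounded set `D`, so the quotients converge to `v`
in `E` itself.

Since `g ∘ f'` is the derivative of `g ∘ f`, induction lowers the order until only `C¹` is left. -/

theorem exists_lipschitz_of_contDiffOn (hΩ : IsOpen Ω) (hφ : ContDiffOn ℝ 1 φ Ω) {K : Set ℝ}
    (hK : IsCompact K) (hKΩ : K ⊆ Ω) :
    ∃ C : ℝ, 0 ≤ C ∧ ∀ x ∈ K, ∀ y ∈ K, ‖φ x - φ y‖ ≤ C * |x - y| := by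
  have hloc : LocallyLipschitzOn K φ := fun x hx => by
    obtain ⟨C, t, ht, h⟩ :=
      (hφ.contDiffAt (hΩ.mem_nhds (hKΩ hx))).exists_lipschitzOnWith
    exact ⟨C, t, mem_nhdsWithin_of_mem_nhds ht, h⟩
  obtain ⟨C, hC⟩ := hloc.exists_lipschitzOnWith_of_compact hK
  refine ⟨C, C.2, fun x hx y hy => ?_⟩
  simpa [dist_eq_norm, Real.norm_eq_abs] using hC.dist_le_mul x hx y hy

/-- For a `C²` function the difference quotients at `x` converge to the derivative at a linear
rate. -/
theorem exists_slope_sub_deriv_le (hΩ : IsOpen Ω) (hφ : ContDiffOn ℝ 2 φ Ω) {x δ : ℝ}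
    (hδ : 0 < δ) (hx : Metric.closedBall x δ ⊆ Ω) :
    ∃ L : ℝ, 0 ≤ L ∧ ∀ h : ℝ, h ≠ 0 → |h| ≤ δ →
      ‖h⁻¹ • (φ (x + h) - φ x) - deriv φ x‖ ≤ L * |h| := by
  obtain ⟨hd, -, hd'⟩ := (contDiffOn_succ_iff_deriv_of_isOpen (n := 1) hΩ).1
    (by simpa [one_add_one_eq_two] using hφ)
  obtain ⟨L, hL0, hL⟩ := exists_lipschitz_of_contDiffOn hΩ hd' (isCompact_closedBall x δ) hx
  refine ⟨L, hL0, fun h h0 hh => ?_⟩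
  have hsub : Metric.closedBall x |h| ⊆ Metric.closedBall x δ :=
    Metric.closedBall_subset_closedBall hh
  -- Mean value inequality for `φ` minus its linear part at `x`: the derivative of the difference is
  -- at most `L * |h|` on this ball.
  have key := (convex_closedBall x |h|).norm_image_sub_le_of_norm_hasDerivWithin_le
    (f := fun t => φ t - (t - x) • deriv φ x) (f' := fun t => deriv φ t - (1 : ℝ) • deriv φ x)
    (C := L * |h|) (x := x) (y := x + h)
    (fun t ht => by
      have h1 : HasDerivAt φ (deriv φ t) t :=
        (hd.differentiableAt (hΩ.mem_nhds (hx (hsub ht)))).hasDerivAt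
      exact (h1.sub (((hasDerivAt_id t).sub_const x).smul_const (deriv φ x))).hasDerivWithinAt)
    (fun t ht => by
      have h1 := hL t (hsub ht) x (Metric.mem_closedBall_self hδ.le)
      rw [one_smul]
      refine h1.trans (mul_le_mul_of_nonneg_left ?_ hL0)
      simpa [Real.dist_eq] using ht)
    (Metric.mem_closedBall_self (abs_nonneg h)) (by simp)
  have e : h⁻¹ • (φ (x + h) - φ x) - deriv φ x
      = h⁻¹ • ((φ (x + h) - (x + h - x) • deriv φ x) - (φ x - (x - x) • deriv φ x)) := by
    rw [add_sub_cancel_left, sub_self, zero_smul, sub_zero, sub_right_comm, smul_sub h⁻¹ (_ - _),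
      inv_smul_smul₀ h0]
  rw [e, norm_smul, norm_inv, Real.norm_eq_abs, inv_mul_le_iff₀ (abs_pos.2 h0)]
  refine key.trans (le_of_eq ?_)
  rw [add_sub_cancel_left, Real.norm_eq_abs]
  ring

end Scalar

theorem ofReal_smul_eq {𝕜 : Type*} [RCLike 𝕜] {E : Type*} [AddCommGroup E] [Module 𝕜 E]
    [Module ℝ E] [IsScalarTower ℝ 𝕜 E] (r : ℝ) (y : E) : (r : 𝕜) • y = r • y := by
  rw [← RCLike.algebraMap_eq_ofReal, algebraMap_smul]

theorem seminorm_real_smul {𝕜 : Type*} [RCLike 𝕜] {E : Type*} [AddCommGroup E] [Module 𝕜 E]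
    [Module ℝ E] [IsScalarTower ℝ 𝕜 E] (p : Seminorm 𝕜 E) (r : ℝ) (y : E) :
    p (r • y) = |r| * p y := by
  rw [← ofReal_smul_eq (𝕜 := 𝕜), map_smul_eq_mul, RCLike.norm_ofReal]

variable {𝕜 : Type*} [RCLike 𝕜] {E : Type*} [AddCommGroup E] [Module 𝕜 E]
  [TopologicalSpace E]

/-! ### Bounded sets, seminorms and real scalars -/

section Bounded

theorem exists_bound_seminorm {B : Set E} (hB : IsVonNBounded 𝕜 B) (p : Seminorm 𝕜 E)
    (hp : Continuous p) : ∃ C : ℝ, 0 ≤ C ∧ ∀ b ∈ B, p b ≤ C := by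
  have h0 : p.ball 0 1 ∈ 𝓝 (0 : E) := by
    have h1 : Tendsto p (𝓝 0) (𝓝 0) := by simpa using hp.tendsto 0
    filter_upwards [h1.eventually (gt_mem_nhds one_pos)] with y hy
    simpa [Seminorm.mem_ball] using hy
  obtain ⟨r, hr, h⟩ := (hB h0).exists_pos
  refine ⟨r, hr.le, fun b hb => ?_⟩
  obtain ⟨y, hy, rfl⟩ := h (r : 𝕜) (by simp [abs_of_pos hr]) hb
  have hy' : p y < 1 := by simpa [Seminorm.mem_ball] using hy
  have e : p ((r : 𝕜) • y) = r * p y := by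
    rw [map_smul_eq_mul, RCLike.norm_ofReal, abs_of_pos hr]
  change p ((r : 𝕜) • y) ≤ r
  rw [e]
  nlinarith

variable [Module ℝ E] [IsScalarTower ℝ 𝕜 E]

theorem map_real_smul_eq (g : E →L[𝕜] 𝕜) (r : ℝ) (y : E) : g (r • y) = r • g y := by
  rw [← ofReal_smul_eq (𝕜 := 𝕜), map_smul, ofReal_smul_eq]

theorem tendsto_real_smul_zero {B : Set E} (hB : IsVonNBounded 𝕜 B) {ι : Type*} {l : Filter ι}
    {c : ι → ℝ} {y : ι → E} (hc : Tendsto c l (𝓝 0)) (hy : ∀ᶠ i in l, y i ∈ B) :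
    Tendsto (fun i => c i • y i) l (𝓝 0) := by
  have h1 : Tendsto (fun i => ((c i : ℝ) : 𝕜)) l (𝓝 0) := by
    exact ((RCLike.continuous_ofReal (K := 𝕜)).tendsto' 0 0 RCLike.ofReal_zero).comp hc
  exact (hB.smul_tendsto_zero hy h1).congr fun i => ofReal_smul_eq _ _

end Bounded

/-! ### From weakly `C¹` to Lipschitz and continuous -/

section Lipschitz

variable [Module ℝ E] [IsScalarTower ℝ 𝕜 E] {G : Submodule 𝕜 (E →L[𝕜] 𝕜)}
  {Ω : Set ℝ} {f : ℝ → E}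

/-- The diagonal `x = y` is harmless: it only contributes `0`. -/
theorem isVonNBounded_slopes (hG : DeterminesBoundedness G) (hΩ : IsOpen Ω)
    (hf : ∀ g ∈ G, ContDiffOn ℝ 1 (fun x => g (f x)) Ω) {K : Set ℝ} (hK : IsCompact K)
    (hKΩ : K ⊆ Ω) :
    IsVonNBounded 𝕜 {b : E | ∃ x ∈ K, ∃ y ∈ K, b = (x - y)⁻¹ • (f x - f y)} := by
  refine hG _ fun g hg => ?_
  obtain ⟨C, hC0, hC⟩ := exists_lipschitz_of_contDiffOn hΩ (hf g hg) hK hKΩ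
  refine isBounded_iff_forall_norm_le.2 ⟨C, ?_⟩
  rintro _ ⟨_, ⟨x, hx, y, hy, rfl⟩, rfl⟩
  rw [map_real_smul_eq, norm_smul, map_sub, norm_inv, Real.norm_eq_abs]
  exact inv_mul_le_of_le_mul₀ (abs_nonneg _) hC0 (by simpa [mul_comm] using hC x hx y hy)

theorem isLipschitzOn_of_weak (hG : DeterminesBoundedness G) (hΩ : IsOpen Ω)
    (hf : ∀ g ∈ G, ContDiffOn ℝ 1 (fun x => g (f x)) Ω) {K : Set ℝ} (hK : IsCompact K)
    (hKΩ : K ⊆ Ω) : IsLipschitzOn 𝕜 f K := by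
  intro p hp
  obtain ⟨C, -, hC⟩ := exists_bound_seminorm (isVonNBounded_slopes hG hΩ hf hK hKΩ) p hp
  refine ⟨C, fun x hx y hy => ?_⟩
  rcases eq_or_ne x y with rfl | hxy
  · simp
  have h := hC _ ⟨x, hx, y, hy, rfl⟩
  rw [seminorm_real_smul, abs_inv, inv_mul_le_iff₀ (abs_pos.2 (sub_ne_zero.2 hxy))] at h
  linarith

theorem continuousOn_of_weak [IsTopologicalAddGroup E] (hG : DeterminesBoundedness G)
    (hΩ : IsOpen Ω) (hf : ∀ g ∈ G, ContDiffOn ℝ 1 (fun x => g (f x)) Ω) : ContinuousOn f Ω := by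
  intro x hx
  obtain ⟨δ, hδ, hball⟩ := Metric.nhds_basis_closedBall.mem_iff.1 (hΩ.mem_nhds hx)
  -- `f y - f x` is the null scalar `y - x` times a slope from a bounded set.
  have h := tendsto_real_smul_zero (l := 𝓝 x) (c := fun y => y - x)
    (y := fun y => (y - x)⁻¹ • (f y - f x))
    (isVonNBounded_slopes hG hΩ hf (isCompact_closedBall x δ) hball)
    ((continuous_id.sub continuous_const).tendsto' x 0 (sub_self x))
    (by
      filter_upwards [Metric.closedBall_mem_nhds x hδ] with y hy
      exact ⟨y, hy, x, Metric.mem_closedBall_self hδ.le, rfl⟩)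
  refine ContinuousAt.continuousWithinAt ?_
  refine tendsto_sub_nhds_zero_iff.1 (h.congr fun y => ?_)
  rcases eq_or_ne y x with rfl | hyx
  · simp
  · rw [smul_inv_smul₀ (sub_ne_zero.2 hyx)]

end Lipschitz

/-! ### Differentiability almost everywhere -/

section Gelfand

variable [Module ℝ E] [IsScalarTower ℝ 𝕜 E] [ContinuousSMul 𝕜 E]

/-- In a generalised Gelfand space, Lipschitz maps on any compact interval are differentiable
almost everywhere. -/
theorem IsGeneralisedGelfand.ae_Ioo (hE : IsGeneralisedGelfand 𝕜 E) {f : ℝ → E} {a b : ℝ}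
    (hab : a < b) (hf : IsLipschitzOn 𝕜 f (Icc a b)) :
    volume {x | x ∈ Ioo a b ∧ ¬ DerivativeExistsAt f x} = 0 := by
  have : ContinuousSMul ℝ E := IsScalarTower.continuousSMul 𝕜
  have hba : 0 < b - a := sub_pos.2 hab
  have hlip : IsLipschitzOn 𝕜 (fun t => f (a + (b - a) * t)) (Icc 0 1) := by
    intro p hp
    obtain ⟨C, hC⟩ := hf p hp
    have hmem : ∀ t ∈ Icc (0 : ℝ) 1, a + (b - a) * t ∈ Icc a b := fun t ht =>
      ⟨by nlinarith [ht.1], by nlinarith [ht.2]⟩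
    refine ⟨C * (b - a), fun x hx y hy => (hC _ (hmem x hx) _ (hmem y hy)).trans (le_of_eq ?_)⟩
    rw [show a + (b - a) * x - (a + (b - a) * y) = (b - a) * (x - y) by ring, abs_mul,
      abs_of_pos hba, mul_assoc]
  have h := hE _ hlip
  rw [ae_restrict_iff' measurableSet_Ioo, ae_iff] at h
  -- The exceptional set lies in the image, under an affine map, of the null set in `(0,1)`.
  refine measure_mono_null ?_ (addHaar_image_eq_zero_of_differentiableOn_of_addHaar_eq_zero volume
    (f := fun t : ℝ => a + (b - a) * t) (by fun_prop) h)
  rintro x ⟨hx, hnot⟩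
  have hxt : a + (b - a) * ((x - a) / (b - a)) = x := by field_simp; ring
  refine ⟨(x - a) / (b - a), ?_, hxt⟩
  simp only [mem_ofPred_eq, Classical.not_imp]
  refine ⟨⟨div_pos (sub_pos.2 hx.1) hba, (div_lt_one hba).2 (by linarith [hx.2])⟩, ?_⟩
  rintro ⟨v, hv⟩
  refine hnot ⟨(b - a)⁻¹ • v, ?_⟩
  have hs : Tendsto (fun h : ℝ => (b - a)⁻¹ * h) (𝓝[≠] 0) (𝓝[≠] 0) := by
    refine tendsto_nhdsWithin_iff.2 ⟨?_, ?_⟩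
    · refine Tendsto.mono_left ?_ nhdsWithin_le_nhds
      simpa using (continuous_const_mul (b - a)⁻¹).tendsto 0
    · filter_upwards [self_mem_nhdsWithin] with h hh
      exact mul_ne_zero (inv_ne_zero hba.ne') hh
  refine ((hv.comp hs).const_smul (b - a)⁻¹).congr fun h => ?_
  simp only [Function.comp_apply]
  rw [mul_add, ← add_assoc, hxt, mul_inv_cancel_left₀ hba.ne', smul_smul, mul_inv, inv_inv,
    inv_mul_cancel_left₀ hba.ne']

theorem IsGeneralisedGelfand.ae_of_weak (hE : IsGeneralisedGelfand 𝕜 E)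
    {G : Submodule 𝕜 (E →L[𝕜] 𝕜)} (hG : DeterminesBoundedness G) {Ω : Set ℝ} (hΩ : IsOpen Ω)
    {f : ℝ → E} (hf : ∀ g ∈ G, ContDiffOn ℝ 1 (fun x => g (f x)) Ω) :
    ∀ᵐ x ∂(volume.restrict Ω), DerivativeExistsAt f x := by
  rw [ae_restrict_iff' hΩ.measurableSet, ae_iff]
  -- Local nullness suffices, so one compact interval around `x` inside `Ω` is enough.
  refine measure_null_of_locally_null _ fun x hx => ?_
  simp only [mem_ofPred_eq, Classical.not_imp] at hx
  obtain ⟨δ, hδ, hball⟩ := Metric.nhds_basis_closedBall.mem_iff.1 (hΩ.mem_nhds hx.1)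
  rw [Real.closedBall_eq_Icc] at hball
  refine ⟨_, inter_mem_nhdsWithin _ (Ioo_mem_nhds (sub_lt_self x hδ) (lt_add_of_pos_right x hδ)),
    measure_mono_null ?_ (hE.ae_Ioo (by linarith)
      (isLipschitzOn_of_weak hG hΩ hf isCompact_Icc hball))⟩
  rintro y ⟨hy, hy'⟩
  exact ⟨hy', (Classical.not_imp.1 hy).2⟩

end Gelfand

/-! ### Disks cut out by functionals in `G` -/

section WeakDisk

variable {G : Submodule 𝕜 (E →L[𝕜] 𝕜)} {L : (E →L[𝕜] 𝕜) → ℝ}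

/-- The set of all points `y` with `‖g y‖ ≤ L g` for every `g ∈ G`. -/
def weakDisk (G : Submodule 𝕜 (E →L[𝕜] 𝕜)) (L : (E →L[𝕜] 𝕜) → ℝ) : Set E :=
  {y | ∀ g ∈ G, ‖g y‖ ≤ L g}

theorem isClosed_weakDisk : IsClosed (weakDisk G L) := by
  simp only [weakDisk, ofPred_forall]
  exact isClosed_iInter fun g => isClosed_iInter fun _ =>
    isClosed_le (g.continuous.norm) continuous_const

theorem isVonNBounded_weakDisk (hG : DeterminesBoundedness G) :
    IsVonNBounded 𝕜 (weakDisk G L) := by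
  refine hG _ fun g hg => isBounded_iff_forall_norm_le.2 ⟨L g, ?_⟩
  rintro _ ⟨y, hy, rfl⟩
  exact hy g hg

variable [Module ℝ E] [IsScalarTower ℝ 𝕜 E]

theorem isDisk_weakDisk (hG : DeterminesBoundedness G) (hL : ∀ g ∈ G, 0 ≤ L g) :
    IsDisk 𝕜 (weakDisk G L) := by
  refine ⟨⟨0, fun g hg => by simpa using hL g hg⟩, isVonNBounded_weakDisk hG, ?_, ?_⟩
  · refine balanced_iff_smul_mem.2 fun a ha y hy g hg => ?_
    rw [map_smul, norm_smul]
    exact (mul_le_of_le_one_left (norm_nonneg _) ha).trans (hy g hg)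
  · intro y hy z hz a b ha hb hab g hg
    rw [map_add, map_real_smul_eq, map_real_smul_eq]
    refine (norm_add_le _ _).trans ?_
    rw [norm_smul, norm_smul, Real.norm_of_nonneg ha, Real.norm_of_nonneg hb]
    have h1 := mul_le_mul_of_nonneg_left (hy g hg) ha
    have h2 := mul_le_mul_of_nonneg_left (hz g hg) hb
    calc _ ≤ a * L g + b * L g := add_le_add h1 h2
      _ = L g := by rw [← add_mul, hab, one_mul]

theorem mem_smul_weakDisk {r : ℝ} (hr : 0 < r) {y : E} :
    y ∈ r • weakDisk G L ↔ ∀ g ∈ G, ‖g y‖ ≤ r * L g := by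
  rw [mem_smul_set_iff_inv_smul_mem₀ hr.ne']
  refine forall₂_congr fun g hg => ?_
  rw [map_real_smul_eq, norm_smul, norm_inv, Real.norm_of_nonneg hr.le, inv_mul_le_iff₀ hr]

theorem norm_le_gauge_weakDisk (hL : ∀ g ∈ G, 0 ≤ L g) {y : E}
    (hy : y ∈ diskSpace (weakDisk G L)) {g : E →L[𝕜] 𝕜} (hg : g ∈ G) :
    ‖g y‖ ≤ gauge (weakDisk G L) y * L g := by
  -- Nonemptiness matters: the gauge is an infimum, with value `0` on the empty set. The witness is
  -- `n + 1` because `n` may be `0`.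
  have hne : {r : ℝ | r ∈ Ioi (0 : ℝ) ∧ y ∈ r • weakDisk G L}.Nonempty := by
    obtain ⟨n, hn⟩ := mem_iUnion.1 hy
    refine ⟨n + 1, by simp only [mem_Ioi]; positivity,
      (mem_smul_weakDisk (by positivity)).2 fun g' hg' => ?_⟩
    obtain ⟨z, hz, rfl⟩ := hn
    change ‖g' ((n : ℝ) • z)‖ ≤ _
    rw [map_real_smul_eq, norm_smul, Real.norm_of_nonneg (Nat.cast_nonneg n)]
    have := mul_le_mul_of_nonneg_left (hz g' hg') (Nat.cast_nonneg (α := ℝ) n)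
    linarith [hL g' hg']
  rcases (hL g hg).eq_or_lt with h0 | hpos
  · obtain ⟨r, hr, hy'⟩ := hne
    have := (mem_smul_weakDisk hr).1 hy' g hg
    simpa [← h0] using this
  · rw [← div_le_iff₀ hpos]
    refine le_csInf hne ?_
    rintro r ⟨hr, hy'⟩
    exact (div_le_iff₀ hpos).2 ((mem_smul_weakDisk hr).1 hy' g hg)

end WeakDisk

/-! ### Strong derivatives from local completeness -/

section Derivative

variable [Module ℝ E] [IsScalarTower ℝ 𝕜 E]

theorem HasDerivative.hasDerivAt {f : ℝ → E} {v : E} {x : ℝ} (h : HasDerivative f v x)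
    (g : E →L[𝕜] 𝕜) : HasDerivAt (fun x => g (f x)) (g v) x := by
  rw [hasDerivAt_iff_tendsto_slope_zero]
  refine ((g.continuous.tendsto v).comp h).congr fun t => ?_
  simp

theorem DerivativeExistsAt.hasDerivative [T2Space E] {f : ℝ → E} {x : ℝ}
    (h : DerivativeExistsAt f x) : HasDerivative f (derivative f x) x :=
  tendsto_nhds_limUnder h

/-- A weakly Cauchy sequence, with rate independent of the functional up to a constant `L g`, has a
weak limit in a locally complete space. -/
theorem IsLocallyComplete.exists_weak_limit (hE : IsLocallyComplete 𝕜 E)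
    {G : Submodule 𝕜 (E →L[𝕜] 𝕜)} (hG : DeterminesBoundedness G) {L : (E →L[𝕜] 𝕜) → ℝ}
    (hL : ∀ g ∈ G, 0 ≤ L g) {c : ℕ → ℝ} (hc0 : ∀ n, 0 < c n) (hc : Tendsto c atTop (𝓝 0))
    {q : ℕ → E} (hq : ∀ m n, ∀ g ∈ G, ‖g (q m - q n)‖ ≤ (c m + c n) * L g) :
    ∃ v : E, ∀ g ∈ G, Tendsto (fun n => g (q n)) atTop (𝓝 (g v)) := by
  have hD := isDisk_weakDisk hG hL
  have hmem : ∀ {y : E} {r : ℝ}, (∀ g ∈ G, ‖g y‖ ≤ r * L g) → y ∈ diskSpace (weakDisk G L) := by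
    intro y r h
    obtain ⟨N, hN⟩ := exists_nat_gt (max r 0)
    have hN0 : (0 : ℝ) < N := (le_max_right _ _).trans_lt hN
    refine mem_iUnion.2 ⟨N, (mem_smul_weakDisk hN0).2 fun g hg => (h g hg).trans ?_⟩
    exact mul_le_mul_of_nonneg_right ((le_max_left _ _).trans hN.le) (hL g hg)
  -- Only differences of the `q n` are known to lie in `E_D`, hence the shift by `q 0`.
  obtain ⟨w, hw, hlim⟩ := hE _ hD isClosed_weakDisk (fun n => q n - q 0) (fun n => hmem (hq n 0))
    (fun ε hε => by
      obtain ⟨N, hN⟩ := eventually_atTop.1 (hc.eventually (gt_mem_nhds (half_pos hε)))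
      refine ⟨N, fun m hm n hn => ?_⟩
      have hpos : 0 < c m + c n := add_pos (hc0 m) (hc0 n)
      refine (gauge_le_of_mem hpos.le ((mem_smul_weakDisk hpos).2 fun g hg => ?_)).trans_lt
        (by linarith [hN m hm, hN n hn])
      rw [sub_sub_sub_cancel_right]
      exact hq m n g hg)
  obtain ⟨R, hR⟩ := mem_iUnion.1 hw
  refine ⟨w + q 0, fun g hg => ?_⟩
  rw [tendsto_iff_norm_sub_tendsto_zero]
  have hz : Tendsto (fun n => gauge (weakDisk G L) (q n - q 0 - w) * L g) atTop (𝓝 0) := by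
    simpa using hlim.mul_const (L g)
  refine squeeze_zero (fun _ => norm_nonneg _) (fun n => ?_) hz
  have hd : q n - q 0 - w ∈ diskSpace (weakDisk G L) := by
    refine hmem (r := c n + c 0 + R) fun g' hg' => ?_
    obtain ⟨z, hzD, rfl⟩ := hR
    have h2 : ‖g' ((R : ℝ) • z)‖ ≤ R * L g' := by
      rw [map_real_smul_eq, norm_smul, Real.norm_of_nonneg (Nat.cast_nonneg R)]
      exact mul_le_mul_of_nonneg_left (hzD g' hg') (Nat.cast_nonneg R)
    rw [map_sub, add_mul]
    exact (norm_sub_le _ _).trans (add_le_add (hq n 0 g' hg') h2)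
  have e : g (q n) - g (w + q 0) = g (q n - q 0 - w) := by
    rw [map_sub, map_sub, map_add]
    ring
  rw [e]
  exact norm_le_gauge_weakDisk hL hd hg

theorem derivativeExistsAt_of_weak [IsTopologicalAddGroup E] (hE : IsLocallyComplete 𝕜 E)
    {G : Submodule 𝕜 (E →L[𝕜] 𝕜)} (hG : DeterminesBoundedness G) {Ω : Set ℝ} (hΩ : IsOpen Ω)
    {f : ℝ → E} (hf : ∀ g ∈ G, ContDiffOn ℝ 2 (fun x => g (f x)) Ω) {x : ℝ} (hx : x ∈ Ω) :
    DerivativeExistsAt f x := by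
  obtain ⟨δ, hδ, hball⟩ := Metric.nhds_basis_closedBall.mem_iff.1 (hΩ.mem_nhds hx)
  have hex : ∀ g : E →L[𝕜] 𝕜, ∃ L : ℝ, g ∈ G → 0 ≤ L ∧ ∀ h : ℝ, h ≠ 0 → |h| ≤ δ →
      ‖g (h⁻¹ • (f (x + h) - f x)) - deriv (fun y => g (f y)) x‖ ≤ L * |h| := by
    intro g
    by_cases hg : g ∈ G
    · obtain ⟨L, h0, h⟩ := exists_slope_sub_deriv_le hΩ (hf g hg) hδ hball
      exact ⟨L, fun _ => ⟨h0, fun t ht ht' => by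
        simpa only [map_real_smul_eq, map_sub] using h t ht ht'⟩⟩
    · exact ⟨0, fun h => absurd h hg⟩
  choose L hL using hex
  -- Sampling at `h = δ / (n + 1)` keeps `|h| ≤ δ`, where the rate estimate holds.
  have hc0 : ∀ n : ℕ, 0 < δ * (1 / ((n : ℝ) + 1)) := fun n => by positivity
  have hc : Tendsto (fun n : ℕ => δ * (1 / ((n : ℝ) + 1))) atTop (𝓝 0) := by
    simpa using tendsto_one_div_add_atTop_nhds_zero_nat.const_mul δ
  have hcδ : ∀ n : ℕ, |δ * (1 / ((n : ℝ) + 1))| ≤ δ := fun n => by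
    rw [abs_of_pos (hc0 n)]
    refine mul_le_of_le_one_right hδ.le ?_
    rw [div_le_one (by positivity)]
    linarith [Nat.cast_nonneg (α := ℝ) n]
  set c : ℕ → ℝ := fun n => δ * (1 / ((n : ℝ) + 1)) with hcdef
  have hcb : ∀ n, ∀ g ∈ G, ‖g ((c n)⁻¹ • (f (x + c n) - f x)) - deriv (fun y => g (f y)) x‖
      ≤ L g * c n := fun n g hg => by
    have := (hL g hg).2 (c n) (hc0 n).ne' (hcδ n)
    rwa [abs_of_pos (hc0 n)] at this
  obtain ⟨v, hv⟩ := hE.exists_weak_limit hG (fun g hg => (hL g hg).1) hc0 hc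
    (q := fun n => (c n)⁻¹ • (f (x + c n) - f x)) (fun m n g hg => by
      have h1 := hcb m g hg
      have h2 := hcb n g hg
      rw [map_sub]
      refine (norm_sub_le_norm_sub_add_norm_sub _ (deriv (fun y => g (f y)) x) _).trans ?_
      rw [norm_sub_rev (deriv _ _)]
      linarith)
  have hgv : ∀ g ∈ G, g v = deriv (fun y => g (f y)) x := fun g hg => by
    refine tendsto_nhds_unique (hv g hg) (tendsto_iff_norm_sub_tendsto_zero.2 ?_)
    refine squeeze_zero (fun _ => norm_nonneg _) (fun n => hcb n g hg) ?_
    simpa using hc.const_mul (L g)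
  refine ⟨v, tendsto_sub_nhds_zero_iff.1 ?_⟩
  -- The rate estimate puts the error divided by `h` into the weak disk; multiplying back by `h → 0`
  -- gives convergence in `E`.
  have hlim := tendsto_real_smul_zero (l := 𝓝[≠] (0 : ℝ)) (c := fun h => h)
    (y := fun h => h⁻¹ • (h⁻¹ • (f (x + h) - f x) - v))
    (isVonNBounded_weakDisk (L := L) hG) (tendsto_id.mono_left nhdsWithin_le_nhds) (by
      have hδ' : ∀ᶠ h in 𝓝[≠] (0 : ℝ), h ∈ Metric.closedBall (0 : ℝ) δ :=
        nhdsWithin_le_nhds (Metric.closedBall_mem_nhds 0 hδ)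
      filter_upwards [self_mem_nhdsWithin, hδ'] with h h0 hh g hg
      have h1 := (hL g hg).2 h h0 (by simpa using hh)
      rw [map_real_smul_eq, norm_smul, norm_inv, Real.norm_eq_abs,
        inv_mul_le_iff₀ (abs_pos.2 h0), map_sub, hgv g hg]
      linarith)
  refine hlim.congr' ?_
  filter_upwards [self_mem_nhdsWithin] with h h0
  rw [smul_inv_smul₀ h0]

/-- Each strong derivative costs one weak order, so all derivatives up to order `m` remain weakly
`C¹`, which is what the Lipschitz, continuity and a.e. results require. Quantifying over `f` lets
the induction pass to `derivative f`. -/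
theorem isCk_of_weak [IsTopologicalAddGroup E] [T2Space E] (hE : IsLocallyComplete 𝕜 E)
    {G : Submodule 𝕜 (E →L[𝕜] 𝕜)} (hG : DeterminesBoundedness G) {Ω : Set ℝ} (hΩ : IsOpen Ω)
    (m : ℕ) : ∀ f : ℝ → E, (∀ g ∈ G, ContDiffOn ℝ (m + 1 : ℕ) (fun x => g (f x)) Ω) →
      IsCk m f Ω ∧ ∀ j ≤ m, ∀ g ∈ G, ContDiffOn ℝ 1 (fun x => g (iterDerivative j f x)) Ω := by
  induction m with
  | zero =>
    intro f hf
    have hf1 : ∀ g ∈ G, ContDiffOn ℝ 1 (fun x => g (f x)) Ω := by simpa using hf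
    refine ⟨continuousOn_of_weak hG hΩ hf1, fun j hj => ?_⟩
    obtain rfl := Nat.le_zero.1 hj
    exact hf1
  | succ m ih =>
    intro f hf
    have hex : ∀ x ∈ Ω, DerivativeExistsAt f x := fun x hx =>
      derivativeExistsAt_of_weak hE hG hΩ
        (fun g hg => (hf g hg).of_le (by exact_mod_cast (by omega : 2 ≤ m + 1 + 1))) hx
    have hd : ∀ g ∈ G, ContDiffOn ℝ (m + 1 : ℕ) (fun x => g (derivative f x)) Ω := fun g hg => by
      have h := hf g hg
      rw [Nat.cast_succ, contDiffOn_succ_iff_deriv_of_isOpen hΩ] at h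
      exact h.2.2.congr fun x hx => ((hex x hx).hasDerivative.hasDerivAt g).deriv.symm
    obtain ⟨h1, h2⟩ := ih _ hd
    refine ⟨⟨hex, h1⟩, fun j hj => ?_⟩
    cases j with
    | zero => exact fun g hg => (hf g hg).of_le (by exact_mod_cast (by omega : 1 ≤ m + 1 + 1))
    | succ j => exact h2 j (Nat.succ_le_succ_iff.1 hj)

end Derivative

end AlmostWeakStrong

/-! ### The main theorem -/

theorem mainTheorem7 {𝕜 : Type*} [RCLike 𝕜] {E : Type*} [AddCommGroup E] [Module 𝕜 E]
    [Module ℝ E] [IsScalarTower ℝ 𝕜 E] [TopologicalSpace E] [IsTopologicalAddGroup E]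
    [ContinuousSMul 𝕜 E] [LocallyConvexSpace ℝ E] [T2Space E]
    (hE : AlmostWeakStrong.IsLocallyComplete 𝕜 E)
    (hE' : AlmostWeakStrong.IsGeneralisedGelfand 𝕜 E)
    (G : Submodule 𝕜 (E →L[𝕜] 𝕜)) (hG : AlmostWeakStrong.DeterminesBoundedness G)
    (Ω : Set ℝ) (hΩ : IsOpen Ω) (k : ℕ) (hk : 1 ≤ k) (f : ℝ → E)
    (hf : ∀ g ∈ G, ContDiffOn ℝ k (fun x => g (f x)) Ω) :
    AlmostWeakStrong.IsCkLipschitzLoc 𝕜 (k - 1) f Ω ∧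
      ∀ᵐ x ∂(volume.restrict Ω),
        AlmostWeakStrong.DerivativeExistsAt (AlmostWeakStrong.iterDerivative (k - 1) f) x := by
  obtain ⟨m, rfl⟩ : ∃ m, k = m + 1 := ⟨k - 1, by omega⟩
  rw [Nat.add_sub_cancel]
  obtain ⟨hCk, hj⟩ := AlmostWeakStrong.isCk_of_weak hE hG hΩ m f hf
  refine ⟨⟨hCk, fun K hK hKΩ => ⟨fun p hp j hjm => ?_, ?_⟩⟩, hE'.ae_of_weak hG hΩ (hj m le_rfl)⟩
  · exact (hK.image_of_continuousOn (hp.comp_continuousOn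
      ((AlmostWeakStrong.continuousOn_of_weak hG hΩ (hj j hjm)).mono hKΩ))).bddAbove
  · exact AlmostWeakStrong.isLipschitzOn_of_weak hG hΩ (hj m le_rfl) hK hKΩ
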